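/- Let $d\ge 1$, let $u,v\in L^2(\mathbb{R}^d)$ be complex-valued, and let $$A(u,v)(x,y)=\int_{\mathbb{R}^d}u\left(t+\frac{x}{2}\right)\overline{v\left(t-\frac{x}{2}\right)}\,e^{-2i\pi\langle y,t\rangle}\,dt,\qquad x,y\in\mathbb{R}^d,$$ be their radar ambiguity function. Let $M,N$ be real numbers with $\min\{M,N\}=1$, and assume that, for some $j\in\{1,\dots,d\}$, $$\iint_{\mathbb{R}^{d}\times\mathbb{R}^d}|A(u,v)(x,y)|^2\,\frac{e^{\pi|x_j|^2}}{(1+|x_j|)^{M}}\,dx\,dy<+\infty \quad\text{and}\quad \iint_{\mathbb{R}^{d}\times\mathbb{R}^d}|A(u,v)(x,y)|^2\,\frac{e^{\pi|y_j|^2}}{(1+|y_j|)^{N}}\,dx\,dy<+\infty .$$ Then $u=0$ almost everywhere or $v=0$ almost everywhere. -/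

import Mathlib

open MeasureTheory
open scoped ComplexConjugate

noncomputable section

/-- The radar ambiguity function
`A(u,v)(x,y) = ∫ u(t + x/2) * conj (v(t - x/2)) * exp(-2 i π ⟨y,t⟩) dt` on `ℝ^d × ℝ^d`. -/
def ambiguity {d : ℕ} (u v : EuclideanSpace ℝ (Fin d) → ℂ)
    (x y : EuclideanSpace ℝ (Fin d)) : ℂ :=
  ∫ t : EuclideanSpace ℝ (Fin d),
    u (t + (1 / 2 : ℝ) • x) * conj (v (t - (1 / 2 : ℝ) • x)) *
      Complex.exp (-2 * Complex.I * (Real.pi : ℂ) * ((inner ℝ y t : ℝ) : ℂ))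

end

/-! Write A for the ambiguity function and, for a fixed point a of phase space, B(z) = A(a + z) A(a
- z). The algebraic heart is that B is its own symplectic Fourier transform
(`ae_integral_radar_mul_eq`), which comes down to a symmetry of the partial inverse transform of B
(`radarCorrelation_symm`). The parallelogram identity turns the weighted bounds on |A|² into
weighted bounds on |B| (`mul_gaussWeight_le`). Hence, along almost every line in the direction of
y_j, B is the Fourier transform of a complex measure on the x_j-axis, and both the measure and its
transform have critical Gaussian decay.

The problem is now one-dimensional (`fourierLaplace_eq_zero`). The transform Φ is entire, and Ψ(z) =
Φ(z) exp(π z²) is at most a polynomial times exp(π (Re z)²), with polynomial growth in the mean on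
the real axis. Phragmén–Lindelöf in quadrants makes Ψ a polynomial. It is integrable against (1 +
|t|)^(-M) on the imaginary axis and against (1 + |s|)^(-N) on the real axis; whichever exponent
equals 1 forces Ψ = 0.

So B = 0 almost everywhere for every a. Fubini gives A = 0, and injectivity of the Fourier transform
on slices with Fubini again gives u = 0 or v = 0. -/

/-! ### Phragmén–Lindelöf and entire functions of polynomial growth. -/

/-- In the closed right half-plane, `1 + z` is comparable with `1 + ‖z‖`. -/
lemma one_add_norm_le_two_mul_norm_one_add {z : ℂ} (hz : 0 ≤ z.re) : 1 + ‖z‖ ≤ 2 * ‖1 + z‖ := by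
  have h1 : ‖z‖ ^ 2 = z.re ^ 2 + z.im ^ 2 := by rw [Complex.sq_norm, Complex.normSq_apply]; ring
  have h2 : ‖1 + z‖ ^ 2 = (1 + z.re) ^ 2 + z.im ^ 2 := by
    rw [Complex.sq_norm, Complex.normSq_apply]; simp; ring
  refine abs_le_of_sq_le_sq' ?_ (by positivity) |>.2
  nlinarith [norm_nonneg z, sq_nonneg (‖z‖ - 1)]

/-- The Phragmén–Lindelöf principle in a sector of opening less than `π / 2`, for an entire function
bounded by `(1 + |z|) ^ K * exp (π * (re z) ^ 2)` and polynomially bounded on the real axis. -/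
lemma norm_mul_exp_le_of_sector {Θ : ℂ → ℂ} (hΘ : Differentiable ℂ Θ) {C : ℝ} {K : ℕ}
    (h1 : ∀ z, ‖Θ z‖ ≤ C * (1 + ‖z‖) ^ K * Real.exp (Real.pi * z.re ^ 2))
    (h2 : ∀ s : ℝ, ‖Θ s‖ ≤ C * (1 + |s|) ^ K) {θ : ℝ} (hθ : 0 < θ) (hθ' : θ < Real.pi / 2)
    {w : ℂ} (hw : 0 ≤ w.im) (hw' : w.im ≤ θ) :
    ‖Θ (Complex.exp w) * Complex.exp (Complex.I * ((Real.pi / 2 * Real.cot θ : ℝ) : ℂ) *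
      Complex.exp w ^ 2) / (1 + Complex.exp w) ^ K‖ ≤ C * 2 ^ K := by
  have hC : 0 ≤ C := by have := (norm_nonneg _).trans (h2 0); simpa using this
  -- For z of argument φ, exp(i b z²) has modulus exp(-b |z|² sin 2φ). This is 1 on the real ray,
  -- and b sin 2θ = π cos² θ makes it cancel exp(π (Re z)²) exactly on the ray φ = θ.
  set b : ℝ := Real.pi / 2 * Real.cot θ with hb
  have hre : ∀ z : ℂ, 0 ≤ z.im → z.im ≤ θ → 0 ≤ (Complex.exp z).re := fun z hz hz' ↦ by
    rw [Complex.exp_re]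
    exact mul_nonneg (Real.exp_pos _).le (Real.cos_nonneg_of_mem_Icc ⟨by linarith, by linarith⟩)
  have hge : ∀ z : ℂ, 0 ≤ z.im → z.im ≤ θ → 1 ≤ ‖1 + Complex.exp z‖ := fun z hz hz' ↦ by
    refine le_trans ?_ (Complex.abs_re_le_norm _)
    rw [Complex.add_re, Complex.one_re]
    exact le_trans (by linarith [hre z hz hz']) (le_abs_self _)
  have hne : ∀ z : ℂ, 0 ≤ z.im → z.im ≤ θ → 1 + Complex.exp z ≠ 0 := fun z hz hz' h ↦ by
    have := hge z hz hz'; rw [h, norm_zero] at this; linarith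
  have hpoly : ∀ z : ℂ, 0 ≤ z.im → z.im ≤ θ →
      (1 + ‖Complex.exp z‖) ^ K / ‖1 + Complex.exp z‖ ^ K ≤ 2 ^ K := fun z hz hz' ↦ by
    rw [← div_pow]
    refine pow_le_pow_left₀ (by positivity) ?_ K
    rw [div_le_iff₀ (by linarith [hge z hz hz'])]
    exact one_add_norm_le_two_mul_norm_one_add (hre z hz hz')
  have hexp : ∀ z : ℂ, ‖Complex.exp (Complex.I * (b : ℂ) * Complex.exp z ^ 2)‖ =
      Real.exp (-(b * (Real.exp z.re ^ 2 * Real.sin (2 * z.im)))) := fun z ↦ by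
    rw [Complex.norm_exp, ← Complex.exp_nat_mul, Complex.mul_re]
    simp [Complex.exp_im, ← Real.exp_nat_mul]
  refine PhragmenLindelof.horizontal_strip (a := 0) (b := θ)
    (f := fun w ↦ Θ (Complex.exp w) * Complex.exp (Complex.I * (b : ℂ) * Complex.exp w ^ 2) /
      (1 + Complex.exp w) ^ K) ?_ ?_ ?_ ?_ hw hw'
  · refine DifferentiableOn.diffContOnCl ?_
    intro z hz
    have hz2 : z ∈ Complex.im ⁻¹' Set.Icc 0 θ := by
      rw [← closure_Ioo hθ.ne, ← Complex.closure_preimage_im]; exact hz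
    refine DifferentiableAt.differentiableWithinAt ?_
    refine DifferentiableAt.div (by fun_prop) (by fun_prop) (pow_ne_zero _ (hne z hz2.1 hz2.2))
  -- Order 2 in |z| = exp (Re w) is admissible because 2 < π / θ; this is why the quadrant itself is
  -- out of reach here.
  · refine ⟨2, ?_, K + Real.pi + |b|, ?_⟩
    · rw [lt_div_iff₀ (by linarith)]; linarith
    refine Asymptotics.IsBigO.of_bound C ?_
    refine Filter.mem_inf_of_right ?_
    intro z hz
    have hz1 : 0 ≤ z.im := hz.1.le
    have hz2 : z.im ≤ θ := hz.2.le
    set R := Real.exp |z.re| with hR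
    have hR1 : 1 ≤ R := Real.one_le_exp (abs_nonneg _)
    have hnR : ‖Complex.exp z‖ ≤ R := by
      rw [Complex.norm_exp]; exact Real.exp_le_exp.2 (le_abs_self _)
    have hR2 : Real.exp (2 * |z.re|) = R ^ 2 := by rw [hR, ← Real.exp_nat_mul]; simp
    have e1 : (1 + ‖Complex.exp z‖) ^ K ≤ Real.exp (K * R ^ 2) := by
      rw [Real.exp_nat_mul]
      refine pow_le_pow_left₀ (by positivity) ?_ K
      calc 1 + ‖Complex.exp z‖ ≤ R ^ 2 + 1 := by nlinarith
        _ ≤ _ := Real.add_one_le_exp _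
    have e2 : Real.exp (Real.pi * (Complex.exp z).re ^ 2) ≤ Real.exp (Real.pi * R ^ 2) := by
      refine Real.exp_le_exp.2 (mul_le_mul_of_nonneg_left ?_ Real.pi_pos.le)
      exact sq_le_sq' (by linarith [neg_abs_le (Complex.exp z).re, Complex.abs_re_le_norm (Complex.exp z)])
        ((Complex.re_le_norm _).trans hnR)
    have e3 : ‖Complex.exp (Complex.I * (b : ℂ) * Complex.exp z ^ 2)‖ ≤ Real.exp (|b| * R ^ 2) := by
      refine (Complex.norm_exp_le_exp_norm _).trans (Real.exp_le_exp.2 ?_)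
      simp only [norm_mul, Complex.norm_I, one_mul, Complex.norm_real, norm_pow, Real.norm_eq_abs]
      gcongr
    have e4 : 1 ≤ ‖1 + Complex.exp z‖ ^ K := one_le_pow₀ (hge z hz1 hz2)
    rw [Set.mem_ofPred_eq, norm_div, norm_mul, norm_pow, Real.norm_of_nonneg (Real.exp_pos _).le, hR2]
    calc _ ≤ ‖Θ (Complex.exp z)‖ *
          ‖Complex.exp (Complex.I * (b : ℂ) * Complex.exp z ^ 2)‖ := div_le_self (by positivity) e4
      _ ≤ (C * Real.exp (K * R ^ 2) * Real.exp (Real.pi * R ^ 2)) * Real.exp (|b| * R ^ 2) := by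
        gcongr
        exact (h1 _).trans (by gcongr)
      _ = C * Real.exp ((K + Real.pi + |b|) * R ^ 2) := by
        rw [mul_assoc, mul_assoc, ← Real.exp_add, ← Real.exp_add]; ring_nf
  · intro z hz
    have h0 : Complex.exp z = ((Real.exp z.re : ℝ) : ℂ) := by
      conv_lhs => rw [← Complex.re_add_im z, hz]
      simp
    have hn : ‖Complex.exp z‖ = |Real.exp z.re| := by rw [h0, Complex.norm_real, Real.norm_eq_abs]
    rw [norm_div, norm_mul, hexp, hz, norm_pow]
    simp only [mul_zero, Real.sin_zero, neg_zero, Real.exp_zero, mul_one]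
    calc _ ≤ C * (1 + ‖Complex.exp z‖) ^ K / ‖1 + Complex.exp z‖ ^ K := by
          gcongr
          rw [hn, h0]; exact h2 _
      _ ≤ C * 2 ^ K := by
          rw [mul_div_assoc]
          exact mul_le_mul_of_nonneg_left (hpoly z hz.ge (by linarith)) hC
  · intro z hz
    rw [norm_div, norm_mul, hexp, hz, norm_pow]
    have hsin : 0 < Real.sin θ := Real.sin_pos_of_pos_of_lt_pi hθ (by linarith [Real.pi_pos])
    have key : Real.exp (Real.pi * (Complex.exp z).re ^ 2) *
        Real.exp (-(b * (Real.exp z.re ^ 2 * Real.sin (2 * θ)))) = 1 := by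
      rw [← Real.exp_add, Real.exp_eq_one_iff, Complex.exp_re, hz, hb, Real.sin_two_mul,
        Real.cot_eq_cos_div_sin]
      field_simp
      ring
    calc _ ≤ C * (1 + ‖Complex.exp z‖) ^ K * Real.exp (Real.pi * (Complex.exp z).re ^ 2) *
          Real.exp (-(b * (Real.exp z.re ^ 2 * Real.sin (2 * θ)))) / ‖1 + Complex.exp z‖ ^ K := by
          gcongr
          exact h1 _
      _ = C * ((1 + ‖Complex.exp z‖) ^ K / ‖1 + Complex.exp z‖ ^ K) := by
          rw [mul_assoc, key]; ring
      _ ≤ C * 2 ^ K := mul_le_mul_of_nonneg_left (hpoly z (by linarith) hz.le) hC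

/-- Let θ increase to π / 2 in the sector estimate: cot θ tends to 0, so the auxiliary exponential
disappears. The imaginary axis lies in no such sector, but there the Gaussian in `h1` equals 1. -/
lemma norm_le_of_quadrant {Θ : ℂ → ℂ} (hΘ : Differentiable ℂ Θ) {C : ℝ} {K : ℕ}
    (h1 : ∀ z, ‖Θ z‖ ≤ C * (1 + ‖z‖) ^ K * Real.exp (Real.pi * z.re ^ 2))
    (h2 : ∀ s : ℝ, ‖Θ s‖ ≤ C * (1 + |s|) ^ K) {z : ℂ} (hre : 0 ≤ z.re) (him : 0 ≤ z.im) :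
    ‖Θ z‖ ≤ C * 2 ^ K * (1 + ‖z‖) ^ K := by
  have hC : 0 ≤ C := by have := (norm_nonneg _).trans (h2 0); simpa using this
  have hK : (1 : ℝ) ≤ 2 ^ K := one_le_pow₀ (by norm_num)
  rcases hre.eq_or_lt with h0 | hpos
  · refine (h1 z).trans ?_
    rw [← h0]
    simp only [ne_eq, OfNat.ofNat_ne_zero, not_false_eq_true, zero_pow, mul_zero, Real.exp_zero,
      mul_one]
    gcongr
    exact le_mul_of_one_le_right hC hK
  have hz : z ≠ 0 := fun h ↦ by simp [h] at hpos
  have harg0 : 0 ≤ z.arg := Complex.arg_nonneg_iff.2 him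
  have harg : z.arg < Real.pi / 2 :=
    (Complex.abs_arg_lt_pi_div_two_iff.2 (Or.inl hpos)).trans_le' (le_abs_self _)
  have hone : 1 + z ≠ 0 := fun h ↦ by
    have := congrArg Complex.re h; simp at this; linarith
  have key : ∀ᶠ θ in nhdsWithin (Real.pi / 2) (Set.Iio (Real.pi / 2)),
      ‖Θ z * Complex.exp (Complex.I * ((Real.pi / 2 * Real.cot θ : ℝ) : ℂ) * z ^ 2) /
        (1 + z) ^ K‖ ≤ C * 2 ^ K := by
    filter_upwards [Ioo_mem_nhdsLT (max_lt harg (by positivity : (0 : ℝ) < Real.pi / 2))] with θ hθ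
    have := norm_mul_exp_le_of_sector hΘ h1 h2 ((le_max_right _ _).trans_lt hθ.1) hθ.2
      (w := Complex.log z) (by rwa [Complex.log_im])
      (by rw [Complex.log_im]; exact ((le_max_left _ _).trans_lt hθ.1).le)
    rwa [Complex.exp_log hz] at this
  have hcot : ContinuousAt Real.cot (Real.pi / 2) := by
    have : Real.cot = fun x ↦ Real.cos x / Real.sin x := funext Real.cot_eq_cos_div_sin
    rw [this]
    exact Real.continuous_cos.continuousAt.div Real.continuous_sin.continuousAt (by simp)
  have hlim : Filter.Tendsto (fun θ : ℝ ↦ ‖Θ z * Complex.exp (Complex.I *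
      ((Real.pi / 2 * Real.cot θ : ℝ) : ℂ) * z ^ 2) / (1 + z) ^ K‖)
      (nhdsWithin (Real.pi / 2) (Set.Iio (Real.pi / 2))) (nhds (‖Θ z / (1 + z) ^ K‖)) := by
    have hc : ContinuousAt (fun θ : ℝ ↦ ‖Θ z * Complex.exp (Complex.I *
      ((Real.pi / 2 * Real.cot θ : ℝ) : ℂ) * z ^ 2) / (1 + z) ^ K‖) (Real.pi / 2) := by
      fun_prop
    have := hc.tendsto
    rw [Real.cot_eq_cos_div_sin] at this
    simp only [Real.cos_pi_div_two, zero_div, mul_zero, Complex.ofReal_zero, zero_mul,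
      Complex.exp_zero, mul_one] at this
    exact this.mono_left nhdsWithin_le_nhds
  have := le_of_tendsto hlim key
  rw [norm_div, norm_pow, div_le_iff₀ (by positivity)] at this
  refine this.trans ?_
  gcongr
  simpa using norm_add_le (1 : ℂ) z

/-- Both bounds are invariant under z ↦ conj z and z ↦ -z, which carry the first quadrant to the
others. -/
lemma norm_le_of_forall_quadrants {Θ : ℂ → ℂ} (hΘ : Differentiable ℂ Θ) {C : ℝ} {K : ℕ}
    (h1 : ∀ z, ‖Θ z‖ ≤ C * (1 + ‖z‖) ^ K * Real.exp (Real.pi * z.re ^ 2))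
    (h2 : ∀ s : ℝ, ‖Θ s‖ ≤ C * (1 + |s|) ^ K) (z : ℂ) :
    ‖Θ z‖ ≤ C * 2 ^ K * (1 + ‖z‖) ^ K := by
  have hup : ∀ {Θ : ℂ → ℂ}, Differentiable ℂ Θ →
      (∀ z, ‖Θ z‖ ≤ C * (1 + ‖z‖) ^ K * Real.exp (Real.pi * z.re ^ 2)) →
      (∀ s : ℝ, ‖Θ s‖ ≤ C * (1 + |s|) ^ K) → ∀ z : ℂ, 0 ≤ z.re →
      ‖Θ z‖ ≤ C * 2 ^ K * (1 + ‖z‖) ^ K := by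
    intro Θ hΘ h1 h2 z hz
    rcases le_total 0 z.im with him | him
    · exact norm_le_of_quadrant hΘ h1 h2 hz him
    · have := norm_le_of_quadrant (Θ := conj ∘ Θ ∘ conj) (C := C) (K := K)
        (fun w ↦ by simpa using (hΘ (conj w)).star_conj)
        (fun w ↦ by simpa using h1 (conj w)) (fun s ↦ by simpa using h2 s) (z := conj z)
        (by simpa using hz) (by simpa using him)
      simpa using this
  rcases le_total 0 z.re with hre | hre
  · exact hup hΘ h1 h2 z hre
  · have := hup (Θ := fun w ↦ Θ (-w)) (by fun_prop) (fun w ↦ by simpa using h1 (-w))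
      (fun s ↦ by simpa using h2 (-s)) (-z) (by simpa using hre)
    simpa using this

/-- An entire function of polynomial growth is a polynomial. -/
lemma exists_polynomial_of_norm_le {Θ : ℂ → ℂ} (hΘ : Differentiable ℂ Θ) {C : ℝ} {K : ℕ}
    (h : ∀ z, ‖Θ z‖ ≤ C * (1 + ‖z‖) ^ K) : ∃ p : Polynomial ℂ, ∀ z, Θ z = p.eval z := by
  have hC : 0 ≤ C := by have := (norm_nonneg _).trans (h 0); simpa using this
  have hzero : ∀ n, K < n → iteratedDeriv n Θ 0 = 0 := by
    intro n hn
    have hb : ∀ R : ℝ, 1 ≤ R → ‖iteratedDeriv n Θ 0‖ ≤ n.factorial * C * 2 ^ K / R := by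
      intro R hR
      refine (Complex.norm_iteratedDeriv_le_of_forall_mem_sphere_norm_le (C := C * (2 * R) ^ K) n
        (by linarith : 0 < R) hΘ.diffContOnCl fun z hz ↦ ?_).trans ?_
      · refine (h z).trans ?_
        rw [mem_sphere_zero_iff_norm] at hz
        rw [hz]
        gcongr
        linarith
      · rw [div_le_div_iff₀ (by positivity) (by positivity)]
        have : R ^ K * R ≤ R ^ n := by
          rw [← pow_succ]; exact pow_le_pow_right₀ hR hn
        calc _ = n.factorial * C * 2 ^ K * (R ^ K * R) := by rw [mul_pow]; ring
          _ ≤ _ := by gcongr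
    have ht : Filter.Tendsto (fun R : ℝ ↦ n.factorial * C * 2 ^ K / R) Filter.atTop (nhds 0) :=
      tendsto_const_nhds.div_atTop Filter.tendsto_id
    have := ge_of_tendsto ht ((Filter.eventually_ge_atTop 1).mono hb)
    exact norm_le_zero_iff.1 this
  refine ⟨∑ n ∈ Finset.range (K + 1),
    Polynomial.C ((n.factorial : ℂ)⁻¹ * iteratedDeriv n Θ 0) * Polynomial.X ^ n, fun z ↦ ?_⟩
  rw [← Complex.taylorSeries_eq_of_entire' 0 z hΘ, tsum_eq_sum (s := Finset.range (K + 1))]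
  · simp [Polynomial.eval_finsetSum]
  · intro n hn
    rw [hzero n (by simpa using hn)]
    simp

/-- A polynomial that is integrable against `1 / (1 + |s|)` along a line through the origin
vanishes. -/
lemma polynomial_eq_zero_of_integrable {p : Polynomial ℂ} {c : ℂ} (hc : c ≠ 0)
    (h : Integrable fun s : ℝ ↦ ‖p.eval (c * s)‖ / (1 + |s|)) : p = 0 := by
  by_contra hp
  -- A nonzero polynomial stays away from 0 far out on the ray, so the integrand would dominate a
  -- multiple of 1 / s.
  obtain ⟨ε, hε, hev⟩ : ∃ ε > 0, ∀ᶠ s : ℝ in Filter.atTop, ε ≤ ‖p.eval (c * s)‖ := by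
    rcases lt_or_ge 0 p.degree with hd | hd
    · refine ⟨1, one_pos, ?_⟩
      have : Filter.Tendsto (fun s : ℝ ↦ ‖c * (s : ℂ)‖) Filter.atTop Filter.atTop := by
        simp only [norm_mul, Complex.norm_real, Real.norm_eq_abs]
        exact Filter.tendsto_abs_atTop_atTop.const_mul_atTop (norm_pos_iff.2 hc)
      exact (p.tendsto_norm_atTop hd this).eventually_ge_atTop 1
    · have h0 := Polynomial.eq_C_of_degree_le_zero hd
      refine ⟨‖p.coeff 0‖, norm_pos_iff.2 fun h1 ↦ hp (by rw [h0, h1, map_zero]), ?_⟩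
      refine Filter.Eventually.of_forall fun s ↦ ?_
      rw [h0]; simp
  obtain ⟨a, ha⟩ := Filter.eventually_atTop.1 hev
  refine not_integrableOn_Ioi_inv (a := max a 1) ?_
  refine Integrable.mono' ((h.integrableOn (s := Set.Ioi (max a 1))).const_mul (2 / ε))
    measurable_inv.aestronglyMeasurable ?_
  refine (ae_restrict_iff' measurableSet_Ioi).2 (Filter.Eventually.of_forall fun s hs ↦ ?_)
  have hs1 : 1 < s := (le_max_right _ _).trans_lt hs
  have := ha s ((le_max_left _ _).trans hs.le)
  rw [Real.norm_of_nonneg (by positivity), abs_of_pos (by linarith)]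
  calc s⁻¹ ≤ 2 / ε * (ε / (1 + s)) := by
        have : 2 / ε * (ε / (1 + s)) = 2 / (1 + s) := by field_simp
        rw [this, inv_eq_one_div, div_le_div_iff₀ (by linarith) (by linarith)]; linarith
    _ ≤ _ := by gcongr

/-- An entire function bounded by `(1 + |z|) ^ K * exp (π * (re z) ^ 2)` and of polynomial growth in
the mean on the real axis is a polynomial. -/
lemma exists_polynomial_of_integrable {Ψ : ℂ → ℂ} (hΨ : Differentiable ℂ Ψ) {C : ℝ} {K : ℕ}
    (h1 : ∀ z, ‖Ψ z‖ ≤ C * (1 + ‖z‖) ^ K * Real.exp (Real.pi * z.re ^ 2))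
    (h2 : Integrable fun s : ℝ ↦ ‖Ψ s‖ / (1 + |s|) ^ K) :
    ∃ p : Polynomial ℂ, ∀ z, Ψ z = p.eval z := by
  have hC : 0 ≤ C := by have := (norm_nonneg _).trans (h1 0); simpa using this
  -- A primitive converts growth in the mean on the real axis into a pointwise bound, at the cost of
  -- one power of 1 + |z|.
  obtain ⟨Θ₀, hΘ₀⟩ := hΨ.isExactOn_univ
  set Θ : ℂ → ℂ := fun z ↦ Θ₀ z - Θ₀ 0 with hΘdef
  have hder : ∀ z, HasDerivAt Θ (Ψ z) z := fun z ↦ (hΘ₀ z (Set.mem_univ z)).sub_const _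
  have hdiff : Differentiable ℂ Θ := fun z ↦ (hder z).differentiableAt
  set J := ∫ s : ℝ, ‖Ψ s‖ / (1 + |s|) ^ K with hJ
  have hJ0 : 0 ≤ J := integral_nonneg fun s ↦ by positivity
  have hb1 : ∀ z, ‖Θ z‖ ≤ (C + J) * (1 + ‖z‖) ^ (K + 1) * Real.exp (Real.pi * z.re ^ 2) := by
    intro z
    have := (convex_segment (𝕜 := ℝ) (0 : ℂ) z).norm_image_sub_le_of_norm_hasDerivWithin_le
      (f := Θ) (f' := Ψ) (C := C * (1 + ‖z‖) ^ K * Real.exp (Real.pi * z.re ^ 2))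
      (fun w _ ↦ (hder w).hasDerivWithinAt) ?_ (left_mem_segment ℝ _ _) (right_mem_segment ℝ _ _)
    · have h0 : Θ 0 = 0 := sub_self _
      rw [h0, sub_zero, sub_zero] at this
      refine this.trans ?_
      calc _ = C * ((1 + ‖z‖) ^ K * ‖z‖) * Real.exp (Real.pi * z.re ^ 2) := by ring
        _ ≤ _ := by
          have : (1 + ‖z‖) ^ K * ‖z‖ ≤ (1 + ‖z‖) ^ (K + 1) := by
            rw [pow_succ]; gcongr; linarith
          gcongr
          linarith
    · intro w hw
      rw [segment_eq_image] at hw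
      obtain ⟨t, ⟨ht0, ht1⟩, rfl⟩ := hw
      simp only [smul_zero, zero_add]
      refine (h1 _).trans ?_
      have e1 : ‖t • z‖ ≤ ‖z‖ := by
        rw [norm_smul, Real.norm_of_nonneg ht0]
        exact mul_le_of_le_one_left (norm_nonneg _) ht1
      have e2 : (t • z).re ^ 2 ≤ z.re ^ 2 := by
        rw [Complex.smul_re, smul_eq_mul, mul_pow]
        exact mul_le_of_le_one_left (sq_nonneg _) (pow_le_one₀ ht0 ht1)
      have := Real.pi_pos
      gcongr
  have hb2 : ∀ s : ℝ, ‖Θ s‖ ≤ (C + J) * (1 + |s|) ^ (K + 1) := by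
    intro s
    have hcont : Continuous fun t : ℝ ↦ Ψ t := hΨ.continuous.comp Complex.continuous_ofReal
    have hFTC : ∫ t in (0 : ℝ)..s, Ψ t = Θ s - Θ (0 : ℝ) :=
      intervalIntegral.integral_eq_sub_of_hasDerivAt (fun t _ ↦ (hder t).comp_ofReal)
        (hcont.intervalIntegrable _ _)
    have h0 : Θ ((0 : ℝ) : ℂ) = 0 := by simp [hΘdef]
    rw [h0, sub_zero] at hFTC
    rw [← hFTC]
    refine intervalIntegral.norm_integral_le_integral_norm_uIoc.trans ?_
    calc _ ≤ ∫ t in Set.uIoc 0 s, (1 + |s|) ^ K * (‖Ψ t‖ / (1 + |t|) ^ K) := by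
          refine setIntegral_mono_on ?_ (h2.const_mul _).integrableOn measurableSet_uIoc ?_
          · exact (hcont.norm.intervalIntegrable 0 s).def'
          · intro t ht
            rw [mul_div_left_comm]
            refine le_mul_of_one_le_right (norm_nonneg _) ?_
            rw [one_le_div (by positivity)]
            have : |t| ≤ |s| := by
              simpa using Set.abs_sub_left_of_mem_uIcc (Set.uIoc_subset_uIcc ht)
            gcongr
      _ ≤ ∫ t : ℝ, (1 + |s|) ^ K * (‖Ψ t‖ / (1 + |t|) ^ K) :=
          setIntegral_le_integral (h2.const_mul _)
            (Filter.Eventually.of_forall fun t ↦ by positivity)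
      _ = J * (1 + |s|) ^ K := by rw [integral_const_mul, mul_comm]
      _ ≤ _ := by
          gcongr
          · linarith
          · linarith [abs_nonneg s]
          · omega
  obtain ⟨p, hp⟩ := exists_polynomial_of_norm_le hdiff
    (norm_le_of_forall_quadrants hdiff hb1 hb2)
  refine ⟨Polynomial.derivative p, fun z ↦ ?_⟩
  have : Θ = fun z ↦ p.eval z := funext hp
  have h3 := hder z
  rw [this] at h3
  exact h3.unique (p.hasDerivAt z)

/-! ### Estimates for the critical Gaussian weight. -/

lemma one_add_abs_rpow_le {M : ℝ} (hM : 0 ≤ M) (s t : ℝ) :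
    (1 + |s|) ^ M ≤ (1 + |t|) ^ M * (1 + |s - t|) ^ M := by
  rw [← Real.mul_rpow (by positivity) (by positivity)]
  refine Real.rpow_le_rpow (by positivity) ?_ hM
  have : |s| ≤ |t| + |s - t| := by simpa using abs_add_le t (s - t)
  nlinarith [abs_nonneg t, abs_nonneg (s - t)]

lemma one_add_abs_rpow_le_pow {M : ℝ} {K : ℕ} (hM : M ≤ K) (s : ℝ) :
    (1 + |s|) ^ M ≤ (1 + |s|) ^ K := by
  rw [← Real.rpow_natCast]
  exact Real.rpow_le_rpow_of_exponent_le (by linarith [abs_nonneg s]) hM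

/-- Since (1 + |s|)^K ≤ exp(K |s|), it suffices that K |s| - π s² ≤ K² - s², which π > 3 leaves room
for. -/
lemma one_add_abs_rpow_mul_exp_le {M : ℝ} {K : ℕ} (hM : M ≤ K) (s : ℝ) :
    (1 + |s|) ^ M * Real.exp (-(Real.pi * s ^ 2)) ≤ Real.exp (K ^ 2) * Real.exp (-s ^ 2) := by
  calc _ ≤ Real.exp (K * |s|) * Real.exp (-(Real.pi * s ^ 2)) := by
        gcongr
        refine (one_add_abs_rpow_le_pow hM s).trans ?_
        rw [Real.exp_nat_mul]
        gcongr
        linarith [Real.add_one_le_exp |s|]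
    _ ≤ _ := by
        rw [← Real.exp_add, ← Real.exp_add, Real.exp_le_exp]
        nlinarith [Real.pi_gt_three, sq_nonneg (K - |s|), sq_abs s, sq_nonneg (K : ℝ), sq_nonneg s]

/-- Complete the square, 2yt = t² + y² - (t - y)², and move the polynomial weight from t to y; the
factor in t - y is absorbed by part of the Gaussian. Keeping exp(-(t - y)²) provides integrability
in y later. -/
lemma exp_mul_le_weight {M : ℝ} {K : ℕ} (h0 : 0 ≤ M) (hM : M ≤ K) (y t : ℝ) :
    Real.exp (2 * Real.pi * y * t) ≤ Real.exp (Real.pi * |t| ^ 2) / (1 + |t|) ^ M *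
      (Real.exp (Real.pi * y ^ 2) * (1 + |y|) ^ M * Real.exp (K ^ 2) * Real.exp (-(t - y) ^ 2)) := by
  have hpos : 0 < (1 + |t|) ^ M := by positivity
  rw [div_mul_eq_mul_div, le_div_iff₀ hpos]
  have e : Real.exp (2 * Real.pi * y * t) = Real.exp (Real.pi * |t| ^ 2) *
      Real.exp (Real.pi * y ^ 2) * Real.exp (-(Real.pi * (t - y) ^ 2)) := by
    rw [← Real.exp_add, ← Real.exp_add, sq_abs]; ring_nf
  calc _ ≤ Real.exp (2 * Real.pi * y * t) * ((1 + |y|) ^ M * (1 + |t - y|) ^ M) := by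
        gcongr; exact one_add_abs_rpow_le h0 t y
    _ = Real.exp (Real.pi * |t| ^ 2) * Real.exp (Real.pi * y ^ 2) * (1 + |y|) ^ M *
        ((1 + |t - y|) ^ M * Real.exp (-(Real.pi * (t - y) ^ 2))) := by rw [e]; ring
    _ ≤ Real.exp (Real.pi * |t| ^ 2) * Real.exp (Real.pi * y ^ 2) * (1 + |y|) ^ M *
        (Real.exp (K ^ 2) * Real.exp (-(t - y) ^ 2)) := by
        gcongr ?_ * ?_
        exact one_add_abs_rpow_mul_exp_le hM _
    _ = _ := by ring

/-- Tonelli: the Gaussian integral over the line does not depend on its centre `τ x`. -/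
lemma integrable_mul_exp_neg_sq_sub {X : Type*} [MeasurableSpace X] {μ : Measure X} [SFinite μ]
    {w : X → ℝ} {τ : X → ℝ} (hw : Integrable w μ) (hτ : Measurable τ) :
    Integrable (fun q : ℝ × X ↦ w q.2 * Real.exp (-(τ q.2 - q.1) ^ 2)) (volume.prod μ) := by
  refine (integrable_prod_iff' (hw.aestronglyMeasurable.comp_snd.mul
    (g := fun q : ℝ × X ↦ Real.exp (-(τ q.2 - q.1) ^ 2))
    (Measurable.aestronglyMeasurable (by fun_prop)))).2 ⟨?_, ?_⟩
  · refine Filter.Eventually.of_forall fun x ↦ ?_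
    refine Integrable.const_mul (f := fun t ↦ Real.exp (-(τ x - t) ^ 2)) ?_ (w x)
    have := (integrable_exp_neg_mul_sq one_pos).comp_sub_left (τ x)
    simpa using this
  · refine (hw.norm.mul_const (∫ s : ℝ, Real.exp (-s ^ 2))).congr
      (Filter.Eventually.of_forall fun x ↦ ?_)
    have : ∀ t : ℝ, ‖w x * Real.exp (-(τ x - t) ^ 2)‖ = ‖w x‖ * Real.exp (-(τ x - t) ^ 2) :=
      fun t ↦ by rw [norm_mul, Real.norm_of_nonneg (Real.exp_pos _).le]
    simp only [Pi.mul_apply, this, integral_const_mul]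
    rw [integral_sub_left_eq_self (fun s : ℝ ↦ Real.exp (-s ^ 2)) volume (τ x)]

/-! ### The one-dimensional uncertainty principle. -/

section FourierLaplace

variable {X : Type*} [MeasurableSpace X] {μ : Measure X} {f : X → ℂ} {τ : X → ℝ}

lemma norm_cexp_neg_two_pi_I (z : ℂ) (t : ℝ) :
    ‖Complex.exp (-2 * Real.pi * Complex.I * z * t)‖ = Real.exp (2 * Real.pi * z.im * t) := by
  rw [Complex.norm_exp]
  simp

/-- The Fourier–Laplace transform of a function with all exponential moments is entire. -/
lemma differentiable_fourierLaplace (hf : AEStronglyMeasurable f μ) (hτ : Measurable τ)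
    (h : ∀ y : ℝ, Integrable (fun x ↦ ‖f x‖ * Real.exp (2 * Real.pi * y * τ x)) μ) :
    Differentiable ℂ fun z : ℂ ↦
      ∫ x, f x * Complex.exp (-2 * Real.pi * Complex.I * z * τ x) ∂μ := by
  intro z₀
  have hmeas : ∀ z : ℂ, AEStronglyMeasurable
      (fun x ↦ f x * Complex.exp (-2 * Real.pi * Complex.I * z * τ x)) μ := fun z ↦
    hf.mul (Measurable.aestronglyMeasurable (by fun_prop))
  -- One unit covers the ball of radius 1, the other absorbs the factor 2π|t| ≤ exp(2π|t|) produced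
  -- by differentiation.
  set Y : ℝ := |z₀.im| + 2 with hY
  have hbd : ∀ z ∈ Metric.ball z₀ 1, ∀ t : ℝ,
      2 * Real.pi * |t| * Real.exp (2 * Real.pi * z.im * t) ≤
        Real.exp (2 * Real.pi * Y * t) + Real.exp (2 * Real.pi * (-Y) * t) := by
    intro z hz t
    have hpi := Real.pi_pos
    have h1 : |z.im| ≤ |z₀.im| + 1 := by
      have h2 : |z.im - z₀.im| ≤ ‖z - z₀‖ := by
        rw [← Complex.sub_im]; exact Complex.abs_im_le_norm _
      rw [Metric.mem_ball, dist_eq_norm] at hz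
      have := abs_add_le (z.im - z₀.im) z₀.im
      rw [sub_add_cancel] at this
      linarith
    have h3 : z.im * t ≤ (|z₀.im| + 1) * |t| :=
      (le_abs_self _).trans (by rw [abs_mul]; gcongr)
    calc _ ≤ Real.exp (2 * Real.pi * |t|) * Real.exp (2 * Real.pi * ((|z₀.im| + 1) * |t|)) := by
          refine mul_le_mul (by linarith [Real.add_one_le_exp (2 * Real.pi * |t|)])
            (Real.exp_le_exp.2 ?_) (Real.exp_pos _).le (Real.exp_pos _).le
          rw [mul_assoc]
          exact mul_le_mul_of_nonneg_left h3 (by positivity)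
      _ = Real.exp (2 * Real.pi * (Y * |t|)) := by rw [← Real.exp_add, hY]; ring_nf
      _ ≤ _ := by
          rcases abs_cases t with ⟨ht, _⟩ | ⟨ht, _⟩ <;> rw [ht]
          · rw [← mul_assoc]; linarith [Real.exp_pos (2 * Real.pi * -Y * t)]
          · have : 2 * Real.pi * (Y * -t) = 2 * Real.pi * -Y * t := by ring
            rw [this]; linarith [Real.exp_pos (2 * Real.pi * Y * t)]
  refine (hasDerivAt_integral_of_dominated_loc_of_deriv_le (Metric.ball_mem_nhds z₀ one_pos)
    (F' := fun z x ↦ f x * (Complex.exp (-2 * Real.pi * Complex.I * z * τ x) *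
      (-2 * Real.pi * Complex.I * τ x)))
    (bound := fun x ↦ ‖f x‖ * Real.exp (2 * Real.pi * Y * τ x) +
      ‖f x‖ * Real.exp (2 * Real.pi * (-Y) * τ x))
    (Filter.Eventually.of_forall hmeas) ?_ ?_ ?_ ((h Y).add (h (-Y))) ?_).2.differentiableAt
  · refine (h z₀.im).mono' (hmeas z₀) (Filter.Eventually.of_forall fun x ↦ ?_)
    rw [norm_mul, norm_cexp_neg_two_pi_I]
  · exact hf.mul (Measurable.aestronglyMeasurable (by fun_prop))
  · refine Filter.Eventually.of_forall fun x z hz ↦ ?_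
    rw [norm_mul, norm_mul, norm_cexp_neg_two_pi_I, ← mul_add]
    refine mul_le_mul_of_nonneg_left ?_ (norm_nonneg _)
    refine le_trans (le_of_eq ?_) (hbd z hz (τ x))
    simp [abs_of_pos Real.pi_pos, mul_comm]
  · refine Filter.Eventually.of_forall fun x z _ ↦ ?_
    refine HasDerivAt.const_mul _ ?_
    have : HasDerivAt (fun z : ℂ ↦ -2 * Real.pi * Complex.I * z * τ x)
        (-2 * Real.pi * Complex.I * τ x) z := by
      simpa using ((hasDerivAt_id z).const_mul (-2 * Real.pi * Complex.I)).mul_const (τ x : ℂ)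
    exact this.cexp

/-- A sharp Hardy-type uncertainty principle: a measure `f μ` pushed forward by `τ` and its Fourier
transform cannot both have Gaussian decay with critical weights. -/
theorem fourierLaplace_eq_zero [SFinite μ] (hf : AEStronglyMeasurable f μ) (hτ : Measurable τ)
    {M N : ℝ} (hMN : min M N = 1)
    (hw : Integrable (fun x ↦ ‖f x‖ * (Real.exp (Real.pi * |τ x| ^ 2) / (1 + |τ x|) ^ M)) μ)
    (hΦ : Integrable fun s : ℝ ↦
      ‖∫ x, f x * Complex.exp (-2 * Real.pi * Complex.I * s * τ x) ∂μ‖ *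
        (Real.exp (Real.pi * |s| ^ 2) / (1 + |s|) ^ N)) (z : ℂ) :
    ∫ x, f x * Complex.exp (-2 * Real.pi * Complex.I * z * τ x) ∂μ = 0 := by
  have hM1 : 1 ≤ M := hMN ▸ min_le_left _ _
  have hN1 : 1 ≤ N := hMN ▸ min_le_right _ _
  obtain ⟨K, hK⟩ := exists_nat_ge (max M N)
  have hMK : M ≤ K := (le_max_left _ _).trans hK
  have hNK : N ≤ K := (le_max_right _ _).trans hK
  set w : X → ℝ := fun x ↦ ‖f x‖ * (Real.exp (Real.pi * |τ x| ^ 2) / (1 + |τ x|) ^ M) with hwdef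
  have hw0 : ∀ x, 0 ≤ w x := fun x ↦ by positivity
  set Φ : ℂ → ℂ := fun z ↦ ∫ x, f x * Complex.exp (-2 * Real.pi * Complex.I * z * τ x) ∂μ with hΦd
  have hbound : ∀ y x, ‖f x‖ * Real.exp (2 * Real.pi * y * τ x) ≤
      Real.exp (Real.pi * y ^ 2) * (1 + |y|) ^ M * Real.exp (K ^ 2) *
        (w x * Real.exp (-(τ x - y) ^ 2)) := fun y x ↦ by
    calc _ ≤ ‖f x‖ * _ := mul_le_mul_of_nonneg_left
          (exp_mul_le_weight (by linarith) hMK y (τ x)) (norm_nonneg _)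
      _ = _ := by rw [hwdef]; ring
  have hwint : ∀ y, Integrable (fun x ↦ w x * Real.exp (-(τ x - y) ^ 2)) μ := fun y ↦ by
    refine hw.mono' (hw.aestronglyMeasurable.mul
      (Measurable.aestronglyMeasurable (by fun_prop))) (Filter.Eventually.of_forall fun x ↦ ?_)
    rw [Real.norm_of_nonneg (mul_nonneg (hw0 x) (Real.exp_pos _).le)]
    refine mul_le_of_le_one_right (hw0 x) (Real.exp_le_one_iff.2 (by nlinarith [sq_nonneg (τ x - y)]))
  have hexp : ∀ y : ℝ, Integrable (fun x ↦ ‖f x‖ * Real.exp (2 * Real.pi * y * τ x)) μ := fun y ↦ by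
    refine ((hwint y).const_mul (Real.exp (Real.pi * y ^ 2) * (1 + |y|) ^ M *
      Real.exp (K ^ 2))).mono' (hf.norm.mul (g := fun x ↦ Real.exp (2 * Real.pi * y * τ x))
      (Measurable.aestronglyMeasurable (by fun_prop))) (Filter.Eventually.of_forall fun x ↦ ?_)
    rw [Real.norm_of_nonneg (by positivity)]
    exact hbound y x
  have hΦdiff : Differentiable ℂ Φ := differentiable_fourierLaplace hf hτ hexp
  have hΦb : ∀ z : ℂ, ‖Φ z‖ ≤ Real.exp (Real.pi * z.im ^ 2) * (1 + |z.im|) ^ M *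
      Real.exp (K ^ 2) * ∫ x, w x * Real.exp (-(τ x - z.im) ^ 2) ∂μ := fun z ↦ by
    rw [← integral_const_mul]
    refine norm_integral_le_of_norm_le ((hwint _).const_mul _)
      (Filter.Eventually.of_forall fun x ↦ ?_)
    rw [norm_mul, norm_cexp_neg_two_pi_I]
    exact hbound _ x
  -- Since |exp(π z²)| = exp(π (Re z)² - π (Im z)²), this factor removes the Gaussian growth of Φ in
  -- the imaginary direction and turns the decay on the real axis into integrability against a
  -- power.
  set Ψ : ℂ → ℂ := fun z ↦ Φ z * Complex.exp (Real.pi * z ^ 2) with hΨd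
  have hΨdiff : Differentiable ℂ Ψ := by
    intro z; have := hΦdiff z; fun_prop
  have hgauss : ∀ z : ℂ, ‖Complex.exp (Real.pi * z ^ 2)‖ =
      Real.exp (Real.pi * z.re ^ 2) * Real.exp (-(Real.pi * z.im ^ 2)) := fun z ↦ by
    rw [Complex.norm_exp, ← Real.exp_add]
    congr 1
    simp [pow_two]; ring
  have hΨb : ∀ z : ℂ, ‖Ψ z‖ ≤ Real.exp (Real.pi * z.re ^ 2) * ((1 + |z.im|) ^ M *
      (Real.exp (K ^ 2) * ∫ x, w x * Real.exp (-(τ x - z.im) ^ 2) ∂μ)) := fun z ↦ by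
    rw [hΨd, norm_mul, hgauss]
    calc _ ≤ (Real.exp (Real.pi * z.im ^ 2) * (1 + |z.im|) ^ M *
        Real.exp (K ^ 2) * ∫ x, w x * Real.exp (-(τ x - z.im) ^ 2) ∂μ) *
        (Real.exp (Real.pi * z.re ^ 2) * Real.exp (-(Real.pi * z.im ^ 2))) := by
          gcongr; exact hΦb z
      _ = (Real.exp (Real.pi * z.im ^ 2) * Real.exp (-(Real.pi * z.im ^ 2))) *
          (Real.exp (Real.pi * z.re ^ 2) * ((1 + |z.im|) ^ M *
          (Real.exp (K ^ 2) * ∫ x, w x * Real.exp (-(τ x - z.im) ^ 2) ∂μ))) := by ring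
      _ = _ := by rw [← Real.exp_add, add_neg_cancel, Real.exp_zero, one_mul]
  have hreal : Integrable fun s : ℝ ↦ ‖Ψ s‖ / (1 + |s|) ^ N := by
    refine hΦ.congr (Filter.Eventually.of_forall fun s ↦ ?_)
    have : ‖Ψ s‖ = ‖Φ s‖ * Real.exp (Real.pi * |s| ^ 2) := by
      rw [hΨd, norm_mul, hgauss]; simp
    simp only [this, mul_div_assoc, hΦd]
  have himag : Integrable fun t : ℝ ↦ ‖Ψ (Complex.I * t)‖ / (1 + |t|) ^ M := by
    have hprod := integrable_mul_exp_neg_sq_sub hw hτ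
    refine (hprod.integral_prod_left.const_mul (Real.exp (K ^ 2))).mono' ?_ ?_
    · refine Measurable.aestronglyMeasurable ?_
      have : Measurable fun t : ℝ ↦ Ψ (Complex.I * t) :=
        (hΨdiff.continuous.comp (by fun_prop)).measurable
      exact this.norm.div (by fun_prop)
    · refine Filter.Eventually.of_forall fun t ↦ ?_
      rw [Real.norm_of_nonneg (by positivity), div_le_iff₀ (by positivity)]
      refine (hΨb _).trans (le_of_eq ?_)
      simp
      ring
  have hpoly : ∀ z, ‖Ψ z‖ ≤ (Real.exp (K ^ 2) * ∫ x, w x ∂μ) * (1 + ‖z‖) ^ K *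
      Real.exp (Real.pi * z.re ^ 2) := by
    intro z
    refine (hΨb z).trans ?_
    rw [mul_comm]
    gcongr ?_ * _
    rw [mul_comm]
    have hI : ∫ x, w x * Real.exp (-(τ x - z.im) ^ 2) ∂μ ≤ ∫ x, w x ∂μ := by
      refine integral_mono (hwint _) hw fun x ↦ ?_
      exact mul_le_of_le_one_right (hw0 x)
        (Real.exp_le_one_iff.2 (by nlinarith [sq_nonneg (τ x - z.im)]))
    have hI0 : 0 ≤ ∫ x, w x ∂μ := integral_nonneg hw0
    refine mul_le_mul (by gcongr) ?_ (by positivity) (by positivity)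
    refine (one_add_abs_rpow_le_pow hMK _).trans ?_
    gcongr
    exact Complex.abs_im_le_norm z
  have hpoly' : Integrable fun s : ℝ ↦ ‖Ψ s‖ / (1 + |s|) ^ K := by
    refine hreal.mono' ?_ (Filter.Eventually.of_forall fun s ↦ ?_)
    · refine Measurable.aestronglyMeasurable ?_
      have : Measurable fun t : ℝ ↦ Ψ t :=
        (hΨdiff.continuous.comp (by fun_prop)).measurable
      exact this.norm.div (by fun_prop)
    · rw [Real.norm_of_nonneg (by positivity)]
      gcongr
      exact one_add_abs_rpow_le_pow hNK s
  obtain ⟨p, hp⟩ := exists_polynomial_of_integrable hΨdiff hpoly hpoly'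
  -- If M = 1 use the imaginary axis, if N = 1 the real axis.
  have hp0 : p = 0 := by
    rcases min_choice M N with h | h
    · refine polynomial_eq_zero_of_integrable (c := Complex.I) Complex.I_ne_zero ?_
      rw [← h, hMN] at himag
      simpa [hp] using himag
    · refine polynomial_eq_zero_of_integrable (c := 1) one_ne_zero ?_
      rw [← h, hMN] at hreal
      simpa [hp] using hreal
  have := hp z
  rw [hp0, Polynomial.eval_zero, hΨd] at this
  exact (mul_eq_zero.1 this).resolve_right (Complex.exp_ne_zero _)

end FourierLaplace

/-! ### Symplectic self-duality of the symmetrised product. -/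

section FourierSlices

open scoped FourierTransform RealInnerProductSpace

variable {E : Type*} [NormedAddCommGroup E] [InnerProductSpace ℝ E] [FiniteDimensional ℝ E]
  [MeasurableSpace E] [BorelSpace E]

/-- Fourier inversion almost everywhere. -/
lemma ae_fourier_fourier_eq {f : E → ℂ} (hf : Integrable f) (hf' : Integrable (𝓕 f)) :
    ∀ᵐ x, 𝓕 (𝓕 f) x = f (-x) := by
  have hcont : ∀ {h : E → ℂ}, Integrable h → Continuous (𝓕 h) := fun hh ↦
    VectorFourier.fourierIntegral_continuous Real.continuous_fourierChar continuous_inner hh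
  have hflip : ∀ {h k : E → ℂ}, Integrable h → Integrable k →
      ∫ ξ, 𝓕 h ξ * k ξ = ∫ x, h x * 𝓕 k x := by
    intro h k hh hk
    have := VectorFourier.integral_fourierIntegral_smul_eq_flip (L := innerₗ E)
      Real.continuous_fourierChar continuous_inner hh hk
    rwa [flip_innerₗ] at this
  -- Test against smooth compactly supported functions: the multiplication formula, used twice,
  -- moves both transforms onto a Schwartz function, where inversion holds pointwise.
  refine ae_eq_of_integral_contDiff_smul_eq (hcont hf').locallyIntegrable
    hf.comp_neg.locallyIntegrable fun g hg hgs ↦ ?_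
  have hgs' : HasCompactSupport (fun x ↦ (g x : ℂ)) := hgs.comp_left Complex.ofReal_zero
  let G : SchwartzMap E ℂ := hgs'.toSchwartzMap (Complex.ofRealCLM.contDiff.comp hg)
  have hG : ∀ x, G x = g x := fun x ↦ rfl
  have hGG : ∀ x, 𝓕 (𝓕 (G : E → ℂ)) x = G (-x) := fun x ↦ by
    have h1 := Real.fourierInv_eq_fourier_neg (𝓕 (G : E → ℂ)) (-x)
    rw [neg_neg] at h1
    rw [← h1, G.continuous.fourierInv_fourier_eq G.integrable (𝓕 G).integrable]
  calc ∫ x, g x • 𝓕 (𝓕 f) x = ∫ x, 𝓕 (𝓕 f) x * G x := by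
        simp [hG, Complex.real_smul, mul_comm]
    _ = ∫ x, 𝓕 f x * 𝓕 (G : E → ℂ) x := hflip hf' G.integrable
    _ = ∫ x, f x * 𝓕 (𝓕 (G : E → ℂ)) x := hflip hf (𝓕 G).integrable
    _ = ∫ x, f x * G (-x) := by simp_rw [hGG]
    _ = ∫ x, f (-x) * G x := by
        rw [← integral_neg_eq_self]; simp
    _ = _ := by simp [hG, Complex.real_smul, mul_comm]

lemma measurable_fourier_slice {X : Type*} [MeasurableSpace X] {h : X → E → ℂ}
    (hh : Measurable fun p : X × E ↦ h p.1 p.2) : Measurable fun p : X × E ↦ 𝓕 (h p.1) p.2 := by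
  simp only [Real.fourier_eq']
  refine StronglyMeasurable.measurable (StronglyMeasurable.integral_prod_right
    (f := fun (p : X × E) (t : E) ↦ Complex.exp (↑(-2 * Real.pi * ⟪t, p.2⟫) * Complex.I) •
      h p.1 t) (Measurable.stronglyMeasurable ?_))
  have h1 : Measurable fun q : (X × E) × E ↦ h q.1.1 q.2 :=
    hh.comp (by fun_prop : Measurable fun q : (X × E) × E ↦ (q.1.1, q.2))
  simp only [Function.uncurry_def, smul_eq_mul]
  fun_prop

/-- The function `t ↦ u (t + x / 2) * conj (v (t - x / 2))`, whose Fourier transform is the radar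
ambiguity function at `x`. -/
noncomputable def radarSlice (u v : E → ℂ) (x t : E) : ℂ :=
  u (t + (1 / 2 : ℝ) • x) * conj (v (t - (1 / 2 : ℝ) • x))

lemma integrable_radarSlice {u v : E → ℂ} (hu : MemLp u 2) (hv : MemLp v 2) (x : E) :
    Integrable (radarSlice u v x) := by
  have h1 : MemLp (fun t ↦ u (t + (1 / 2 : ℝ) • x)) 2 :=
    hu.comp_measurePreserving (measurePreserving_add_right _ _)
  have h2 : MemLp (fun t ↦ v (t - (1 / 2 : ℝ) • x)) 2 :=
    hv.comp_measurePreserving (measurePreserving_sub_right _ _)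
  exact h1.integrable_mul h2.star

lemma measurable_radarSlice {u v : E → ℂ} (hu : Measurable u) (hv : Measurable v) :
    Measurable fun p : E × E ↦ radarSlice u v p.1 p.2 := by
  unfold radarSlice
  have : Measurable (conj : ℂ → ℂ) := Complex.continuous_conj.measurable
  fun_prop

/-- The partial inverse Fourier transform in the second variable of the function
`(x, y) ↦ A (α + x) (β + y) * A (α - x) (β - y)`, where `A` is the ambiguity function. -/
noncomputable def radarCorrelation (u v : E → ℂ) (α β x q : E) : ℂ :=
  ∫ m, Real.fourierChar (-⟪(2 : ℝ) • m, β⟫) • (radarSlice u v (α + x) (m + (1 / 2 : ℝ) • q) *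
    radarSlice u v (α - x) (m - (1 / 2 : ℝ) • q))

/-- The factors are u at m + α/2 ± (x + q)/2 and conj v at m - α/2 ± (x - q)/2. Swapping x and q
fixes the former and exchanges the latter. -/
lemma radarCorrelation_symm (u v : E → ℂ) (α β x q : E) :
    radarCorrelation u v α β x q = radarCorrelation u v α β q x := by
  unfold radarCorrelation radarSlice
  refine integral_congr_ae (Filter.Eventually.of_forall fun m ↦ ?_)
  simp only
  congr 1
  have e1 : m + (1 / 2 : ℝ) • q + (1 / 2 : ℝ) • (α + x) =
    m + (1 / 2 : ℝ) • x + (1 / 2 : ℝ) • (α + q) := by module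
  have e2 : m + (1 / 2 : ℝ) • q - (1 / 2 : ℝ) • (α + x) =
    m - (1 / 2 : ℝ) • x - (1 / 2 : ℝ) • (α - q) := by module
  have e3 : m - (1 / 2 : ℝ) • q + (1 / 2 : ℝ) • (α - x) =
    m - (1 / 2 : ℝ) • x + (1 / 2 : ℝ) • (α - q) := by module
  have e4 : m - (1 / 2 : ℝ) • q - (1 / 2 : ℝ) • (α - x) =
    m + (1 / 2 : ℝ) • x - (1 / 2 : ℝ) • (α + q) := by module
  rw [e1, e2, e3, e4]
  ring

lemma measurable_radarCorrelation {u v : E → ℂ} (hu : Measurable u) (hv : Measurable v) (α β : E) :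
    Measurable fun p : E × E ↦ radarCorrelation u v α β p.1 p.2 := by
  unfold radarCorrelation
  refine StronglyMeasurable.measurable (StronglyMeasurable.integral_prod_right
    (f := fun (p : E × E) (m : E) ↦ Real.fourierChar (-⟪(2 : ℝ) • m, β⟫) •
      (radarSlice u v (α + p.1) (m + (1 / 2 : ℝ) • p.2) *
        radarSlice u v (α - p.1) (m - (1 / 2 : ℝ) • p.2))) (Measurable.stronglyMeasurable ?_))
  have h := measurable_radarSlice hu hv
  have h1 : Measurable fun q : (E × E) × E ↦
      radarSlice u v (α + q.1.1) (q.2 + (1 / 2 : ℝ) • q.1.2) :=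
    h.comp (by fun_prop :
      Measurable fun q : (E × E) × E ↦ (α + q.1.1, q.2 + (1 / 2 : ℝ) • q.1.2))
  have h2 : Measurable fun q : (E × E) × E ↦
      radarSlice u v (α - q.1.1) (q.2 - (1 / 2 : ℝ) • q.1.2) :=
    h.comp (by fun_prop :
      Measurable fun q : (E × E) × E ↦ (α - q.1.1, q.2 - (1 / 2 : ℝ) • q.1.2))
  simp only [Function.uncurry_def, Circle.smul_def, Real.fourierChar_apply, smul_eq_mul]
  fun_prop

-- In q this is the convolution of one slice with the reflection of the other, both modulated by β,
-- so its transform is a product. The reflection is what turns β + y into β - y.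
open scoped Convolution in
lemma integrable_radarCorrelation_and_fourier {u v : E → ℂ} (hu : MemLp u 2) (hv : MemLp v 2)
    (α β x : E) : Integrable (radarCorrelation u v α β x) ∧ ∀ y,
      𝓕 (radarCorrelation u v α β x) y =
        𝓕 (radarSlice u v (α + x)) (β + y) * 𝓕 (radarSlice u v (α - x)) (β - y) := by
  set k : E → ℂ := fun t ↦ Real.fourierChar (-⟪t, β⟫) • radarSlice u v (α + x) t with hk
  set l : E → ℂ := fun t ↦ Real.fourierChar (-⟪-t, β⟫) • radarSlice u v (α - x) (-t) with hl
  have hki : Integrable k :=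
    (Real.fourierIntegral_convergent_iff β).2 (integrable_radarSlice hu hv (α + x))
  have hli : Integrable l :=
    ((Real.fourierIntegral_convergent_iff β).2 (integrable_radarSlice hu hv (α - x))).comp_neg
  have hconv : radarCorrelation u v α β x = k ⋆[ContinuousLinearMap.mul ℂ ℂ] l := by
    funext q
    -- Centring the variable at q/2 makes the two arguments m ± q/2; their sum 2m explains the
    -- character in `radarCorrelation`.
    rw [convolution_mul, ← integral_add_right_eq_self _ ((1 / 2 : ℝ) • q)]
    refine integral_congr_ae (Filter.Eventually.of_forall fun m ↦ ?_)
    simp only [hk, hl]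
    have e1 : -(q - (m + (1 / 2 : ℝ) • q)) = m - (1 / 2 : ℝ) • q := by module
    have e2 : (2 : ℝ) • m = (m + (1 / 2 : ℝ) • q) + (m - (1 / 2 : ℝ) • q) := by module
    rw [e1, e2, inner_add_left, neg_add, AddChar.map_add_eq_mul]
    simp only [Circle.smul_def, smul_eq_mul, Circle.coe_mul]
    ring
  refine ⟨hconv ▸ hki.integrable_convolution _ hli, fun y ↦ ?_⟩
  rw [hconv, Real.fourier_mul_convolution_eq hki hli]
  congr 1
  · rw [Real.fourier_eq, Real.fourier_eq]
    refine integral_congr_ae (Filter.Eventually.of_forall fun t ↦ ?_)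
    simp only [hk, smul_smul, ← AddChar.map_add_eq_mul]
    rw [inner_add_right]; ring_nf
  · rw [Real.fourier_eq, Real.fourier_eq, ← integral_neg_eq_self]
    refine integral_congr_ae (Filter.Eventually.of_forall fun t ↦ ?_)
    simp only [hl, smul_smul, ← AddChar.map_add_eq_mul, neg_neg]
    rw [inner_sub_right, inner_neg_left]; ring_nf

/-- The symmetrised product of ambiguity functions is its own symplectic Fourier transform. -/
lemma ae_integral_radar_mul_eq {u v : E → ℂ} (hum : Measurable u) (hvm : Measurable v)
    (hu : MemLp u 2) (hv : MemLp v 2) (α β : E) {B : E × E → ℂ}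
    (hB : ∀ z, B z = 𝓕 (radarSlice u v (α + z.1)) (β + z.2) *
      𝓕 (radarSlice u v (α - z.1)) (β - z.2)) (hBi : Integrable B) :
    ∀ᵐ η : E, ∀ ξ : E, ∫ z : E × E, Real.fourierChar (-(⟪z.1, ξ⟫ + ⟪z.2, η⟫)) • B z =
      B (-η, ξ) := by
  set G := radarCorrelation u v α β with hG
  have hFG : ∀ x, 𝓕 (G x) = fun y ↦ B (x, y) := fun x ↦ funext fun y ↦ by
    rw [hB]; exact (integrable_radarCorrelation_and_fourier hu hv α β x).2 y
  have hGm := measurable_radarCorrelation hum hvm α β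
  have hinv : ∀ᵐ x : E, ∀ᵐ η : E, 𝓕 (fun y ↦ B (x, y)) η = G x (-η) := by
    filter_upwards [hBi.prod_right_ae] with x hx
    rw [← hFG x] at hx ⊢
    exact ae_fourier_fourier_eq (integrable_radarCorrelation_and_fourier hu hv α β x).1 hx
  have hBm : Measurable B := by
    have := measurable_fourier_slice (h := G) hGm
    simpa only [hFG] using this
  -- The inner y-integral is evaluated at a fixed η for almost every x, so the quantifiers must be
  -- exchanged.
  rw [Measure.ae_ae_comm] at hinv
  · filter_upwards [hinv] with η hη ξ
    have hint : Integrable (fun z : E × E ↦ Real.fourierChar (-(⟪z.1, ξ⟫ + ⟪z.2, η⟫)) • B z) := by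
      refine hBi.mono ?_ (Filter.Eventually.of_forall fun z ↦ by simp)
      refine Measurable.aestronglyMeasurable ?_
      simp only [Circle.smul_def, Real.fourierChar_apply, smul_eq_mul]
      fun_prop
    have h1 : (fun y ↦ B (-η, y)) ξ = 𝓕 (G (-η)) ξ := by rw [hFG]
    change _ = (fun y ↦ B (-η, y)) ξ
    rw [h1, Measure.volume_eq_prod, integral_prod _ hint, Real.fourier_eq]
    refine integral_congr_ae ?_
    filter_upwards [hη] with x hx
    -- The inner integral is G x (-η) = G (-η) x, so the remaining x-integral is again a Fourier
    -- transform of a G-slice.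
    rw [hG, radarCorrelation_symm u v α β (-η) x, ← hG, ← hx, Real.fourier_eq,
      Circle.smul_def, ← integral_smul]
    refine integral_congr_ae (Filter.Eventually.of_forall fun y ↦ ?_)
    simp only [neg_add, AddChar.map_add_eq_mul, Circle.smul_def, smul_smul, Circle.coe_mul]
  · have h1 : Measurable fun p : E × E ↦ 𝓕 (fun y ↦ B (p.1, y)) p.2 :=
      measurable_fourier_slice (h := fun x y ↦ B (x, y)) hBm
    have h0 : Measurable fun p : E × E ↦ (p.1, -p.2) := by fun_prop
    have h2 := hGm.comp h0
    exact measurableSet_eq_fun h1 h2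

end FourierSlices

/-! ### From symmetrised products back to the function. -/

section Group

variable {V : Type*} [NormedAddCommGroup V] [NormedSpace ℝ V] [MeasurableSpace V] [BorelSpace V]
  [SecondCountableTopology V] {ν : Measure V} [SFinite ν] [ν.IsAddLeftInvariant]

/-- A function all of whose symmetrised products vanish almost everywhere vanishes almost
everywhere. -/
lemma ae_eq_zero_of_forall_ae_mul_eq_zero {A : V → ℂ} (hA : Measurable A)
    (h : ∀ a, ∀ᵐ z ∂ν, A (a + z) * A (a - z) = 0) : ∀ᵐ z ∂ν, A z = 0 := by
  -- Taking a = p/2 and translating by p/2 isolates A z, so Fubini can fix a z with A z ≠ 0 and let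
  -- p vary.
  have h1 : ∀ p, ∀ᵐ z ∂ν, A z * A (p - z) = 0 := fun p ↦ by
    have := (measurePreserving_sub_right ν ((1 / 2 : ℝ) • p)).quasiMeasurePreserving.ae
      (h ((1 / 2 : ℝ) • p))
    filter_upwards [this] with z hz
    have e1 : (1 / 2 : ℝ) • p + (z - (1 / 2 : ℝ) • p) = z := by module
    have e2 : (1 / 2 : ℝ) • p - (z - (1 / 2 : ℝ) • p) = p - z := by module
    rwa [e1, e2] at hz
  have h2 : ∀ᵐ p ∂ν, ∀ᵐ z ∂ν, A z * A (p - z) = 0 := Filter.Eventually.of_forall h1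
  rw [Measure.ae_ae_comm (p := fun p z ↦ A z * A (p - z) = 0)
    (measurableSet_eq_fun (by fun_prop) measurable_const)] at h2
  by_contra hcon
  obtain ⟨z, hz, hz'⟩ := ((Filter.not_eventually.1 hcon).and_eventually h2).exists
  refine hcon ?_
  have := (measurePreserving_add_right ν z).quasiMeasurePreserving.ae hz'
  filter_upwards [this] with p hp
  rw [add_sub_cancel_right] at hp
  exact (mul_eq_zero.1 hp).resolve_left hz

end Group

/-! ### Transfer of the weights to the product. -/

/-- The Gaussian weight `exp (π t²) / (1 + |t|) ^ M`. -/
noncomputable def gaussWeight (M t : ℝ) : ℝ := Real.exp (Real.pi * |t| ^ 2) / (1 + |t|) ^ M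

lemma gaussWeight_nonneg (M t : ℝ) : 0 ≤ gaussWeight M t := by unfold gaussWeight; positivity

@[fun_prop]
lemma measurable_gaussWeight (M : ℝ) : Measurable (gaussWeight M) := by
  unfold gaussWeight; fun_prop

lemma one_le_mul_gaussWeight {M : ℝ} (hM : 0 ≤ M) :
    ∃ C : ℝ, 0 ≤ C ∧ ∀ t, 1 ≤ C * gaussWeight M t := by
  obtain ⟨K, hK⟩ := exists_nat_ge M
  refine ⟨Real.exp (K ^ 2), (Real.exp_pos _).le, fun t ↦ ?_⟩
  have := exp_mul_le_weight hM hK 0 t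
  rw [mul_comm]
  simp only [mul_zero, zero_mul, Real.exp_zero, ne_eq, OfNat.ofNat_ne_zero, not_false_eq_true,
    zero_pow, abs_zero, add_zero, Real.one_rpow, mul_one, one_mul, sub_zero] at this
  refine this.trans (mul_le_mul_of_nonneg_left ?_ (gaussWeight_nonneg M t))
  exact mul_le_of_le_one_right (Real.exp_pos _).le (Real.exp_le_one_iff.2 (by nlinarith))

/-- By (α + t)² + (α - t)² = 2α² + 2t², the square of the weight at t is at most (1 + |α|)^(2M)
times the product of the weights at α ± t; then pq ≤ (p + q)² for p, q ≥ 0. -/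
lemma mul_gaussWeight_le {M : ℝ} (hM : 0 ≤ M) {a b : ℝ} (α t : ℝ) :
    a * b * gaussWeight M t ≤ (1 + |α|) ^ M *
      (a ^ 2 * gaussWeight M (α + t) + b ^ 2 * gaussWeight M (α - t)) := by
  have key : gaussWeight M t ^ 2 ≤
      ((1 + |α|) ^ M) ^ 2 * (gaussWeight M (α + t) * gaussWeight M (α - t)) := by
    unfold gaussWeight
    rw [div_pow, div_mul_div_comm, mul_div_assoc', div_le_div_iff₀ (by positivity) (by positivity)]
    have e1 : (1 + |α + t|) ^ M ≤ (1 + |α|) ^ M * (1 + |t|) ^ M := by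
      have := one_add_abs_rpow_le hM (α + t) α
      rwa [add_sub_cancel_left] at this
    have e2 : (1 + |α - t|) ^ M ≤ (1 + |α|) ^ M * (1 + |t|) ^ M := by
      have := one_add_abs_rpow_le hM (α - t) α
      rwa [sub_sub_cancel_left, abs_neg] at this
    have e3 : Real.exp (Real.pi * |t| ^ 2) ^ 2 ≤
        Real.exp (Real.pi * |α + t| ^ 2) * Real.exp (Real.pi * |α - t| ^ 2) := by
      rw [← Real.exp_nat_mul, ← Real.exp_add, Real.exp_le_exp, sq_abs, sq_abs, sq_abs]
      push_cast
      nlinarith [mul_nonneg Real.pi_pos.le (sq_nonneg α)]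
    calc _ ≤ (Real.exp (Real.pi * |α + t| ^ 2) * Real.exp (Real.pi * |α - t| ^ 2)) *
          (((1 + |α|) ^ M * (1 + |t|) ^ M) * ((1 + |α|) ^ M * (1 + |t|) ^ M)) := by gcongr
      _ = _ := by ring
  have hp := gaussWeight_nonneg M (α + t)
  have hq := gaussWeight_nonneg M (α - t)
  have hr := gaussWeight_nonneg M t
  have hP : 0 ≤ (1 + |α|) ^ M := by positivity
  refine (abs_le_of_sq_le_sq' ?_ (by positivity)).2
  set p := a ^ 2 * gaussWeight M (α + t) with hpd
  set q := b ^ 2 * gaussWeight M (α - t) with hqd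
  have hp0 : 0 ≤ p := by positivity
  have hq0 : 0 ≤ q := by positivity
  calc (a * b * gaussWeight M t) ^ 2 = (a * b) ^ 2 * gaussWeight M t ^ 2 := by ring
    _ ≤ (a * b) ^ 2 * _ := mul_le_mul_of_nonneg_left key (sq_nonneg _)
    _ = ((1 + |α|) ^ M) ^ 2 * (p * q) := by rw [hpd, hqd]; ring
    _ ≤ ((1 + |α|) ^ M) ^ 2 * (p + q) ^ 2 := by gcongr; nlinarith [mul_nonneg hp0 hq0]
    _ = _ := by ring

/-! ### Reduction to lines and the theorem for a unit direction. -/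

section Directional

open scoped RealInnerProductSpace FourierTransform

variable {E : Type*} [NormedAddCommGroup E] [InnerProductSpace ℝ E] [FiniteDimensional ℝ E]
  [MeasurableSpace E] [BorelSpace E]

/-- An integrable function is integrable along almost every line of a given direction. -/
lemma ae_integrable_line {h : E → ℝ} (hh : Integrable h) {e : E} (he : ‖e‖ = 1) :
    ∀ᵐ y, Integrable fun s : ℝ ↦ h (y + s • e) := by
  -- The Gaussian supplies integrability in s; after the shear y ↦ y + s e its argument is ⟪e, y⟫,
  -- free of s, and it can be divided out on each line.
  have h1 := integrable_mul_exp_neg_sq_sub hh (τ := fun y ↦ ⟪e, y⟫) (by fun_prop)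
  have hmp : MeasurePreserving (fun q : ℝ × E ↦ (q.1, q.2 + q.1 • e))
      (volume.prod volume) (volume.prod volume) :=
    (MeasurePreserving.id volume).skew_product (g := fun s y ↦ y + s • e)
      (by simp only [Function.uncurry_def]; fun_prop)
      (Filter.Eventually.of_forall fun s ↦ map_add_right_eq_self _ _)
  have h2 := hmp.integrable_comp_of_integrable h1
  filter_upwards [h2.prod_left_ae] with y hy
  have h3 := hy.mul_const (Real.exp (-(⟪e, y⟫ ^ 2)))⁻¹
  refine h3.congr (Filter.Eventually.of_forall fun s ↦ ?_)
  have : ⟪e, y + s • e⟫ - s = ⟪e, y⟫ := by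
    rw [inner_add_right, inner_smul_right, real_inner_self_eq_norm_sq, he]; ring
  simp only [Function.comp_apply, this]
  rw [mul_assoc, mul_inv_cancel₀ (Real.exp_pos _).ne', mul_one]

/-- A function on `E × E` equal to its own symplectic Fourier transform with critical Gaussian decay
in one direction of each factor vanishes. -/
lemma ae_eq_zero_of_symplectic_fourier_eq {B : E × E → ℂ} (hBm : Measurable B) {e : E}
    (he : ‖e‖ = 1) {M N : ℝ} (hMN : min M N = 1)
    (hid : ∀ᵐ η : E, ∀ ξ : E,
      ∫ z : E × E, Real.fourierChar (-(⟪z.1, ξ⟫ + ⟪z.2, η⟫)) • B z = B (-η, ξ))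
    (hx : Integrable fun z : E × E ↦ ‖B z‖ * gaussWeight M ⟪e, z.1⟫)
    (hy : Integrable fun z : E × E ↦ ‖B z‖ * gaussWeight N ⟪e, z.2⟫) : ∀ᵐ z, B z = 0 := by
  rw [Measure.volume_eq_prod,
    Measure.ae_prod_iff_ae_ae (measurableSet_eq_fun hBm measurable_const)]
  have hid' := (Measure.measurePreserving_neg (volume : Measure E)).quasiMeasurePreserving.ae hid
  filter_upwards [hid', hy.prod_right_ae] with x hx1 hx2
  rw [neg_neg] at hx1
  filter_upwards [ae_integrable_line hx2 he] with ξ hξ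
  set c := ⟪e, ξ⟫ with hc
  -- The frequency ξ - c e has no component along e, so at parameter s the transform is B at a point
  -- whose e-component is exactly s, matching the weight. The value s = c recovers B (x, ξ).
  set f : E × E → ℂ := fun z ↦
    Real.fourierChar (-(⟪z.1, ξ - c • e⟫ + ⟪z.2, -x⟫)) • B z with hf
  have hfm : Measurable f := by
    simp only [hf, Circle.smul_def, Real.fourierChar_apply, smul_eq_mul]
    fun_prop
  have hker : ∀ s : ℝ, ∫ z, f z * Complex.exp (-2 * Real.pi * Complex.I * s *
      ((⟪e, z.1⟫ : ℝ) : ℂ)) = B (x, ξ + (s - c) • e) := by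
    intro s
    rw [← hx1 (ξ + (s - c) • e)]
    refine integral_congr_ae (Filter.Eventually.of_forall fun z ↦ ?_)
    simp only [hf, Circle.smul_def, Real.fourierChar_apply, smul_eq_mul]
    rw [mul_right_comm, ← Complex.exp_add]
    congr 2
    rw [inner_add_right, inner_sub_right, inner_smul_right, inner_smul_right,
      real_inner_comm e z.1]
    push_cast
    ring
  have hw1 : Integrable fun z ↦ ‖f z‖ *
      (Real.exp (Real.pi * |⟪e, z.1⟫| ^ 2) / (1 + |⟪e, z.1⟫|) ^ M) := by
    refine hx.congr (Filter.Eventually.of_forall fun z ↦ ?_)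
    simp [hf, gaussWeight]
  have hzero := fourierLaplace_eq_zero (μ := volume) (f := f) (τ := fun z : E × E ↦ ⟪e, z.1⟫)
    hfm.aestronglyMeasurable (by fun_prop) hMN hw1 ?_ (c : ℂ)
  · rw [hker c] at hzero
    simpa using hzero
  · have h3 := hξ.comp_sub_right c
    refine h3.congr (Filter.Eventually.of_forall fun s ↦ ?_)
    simp only [hker]
    have : ⟪e, ξ + (s - c) • e⟫ = s := by
      rw [inner_add_right, inner_smul_right, real_inner_self_eq_norm_sq, he, ← hc]; ring
    rw [this]
    rfl

/-- The uncertainty principle for the radar ambiguity function, in the direction of a unit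
vector. -/
lemma radar_ae_eq_zero_or {u v : E → ℂ} (hum : Measurable u) (hvm : Measurable v)
    (hu : MemLp u 2) (hv : MemLp v 2) {e : E} (he : ‖e‖ = 1) {M N : ℝ} (hMN : min M N = 1)
    (hx : Integrable fun z : E × E ↦
      ‖𝓕 (radarSlice u v z.1) z.2‖ ^ 2 * gaussWeight M ⟪e, z.1⟫)
    (hy : Integrable fun z : E × E ↦
      ‖𝓕 (radarSlice u v z.1) z.2‖ ^ 2 * gaussWeight N ⟪e, z.2⟫) :
    u =ᵐ[volume] 0 ∨ v =ᵐ[volume] 0 := by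
  set A : E × E → ℂ := fun z ↦ 𝓕 (radarSlice u v z.1) z.2 with hAd
  have hAm : Measurable A := measurable_fourier_slice (measurable_radarSlice hum hvm)
  have hM0 : 0 ≤ M := zero_le_one.trans (hMN ▸ min_le_left _ _)
  have hN0 : 0 ≤ N := zero_le_one.trans (hMN ▸ min_le_right _ _)
  have : (volume.prod volume : Measure (E × E)).IsNegInvariant :=
    ⟨((Measure.measurePreserving_neg (volume : Measure E)).prod
      (Measure.measurePreserving_neg (volume : Measure E))).map_eq⟩
  have hweight : ∀ {L : ℝ} {ℓ : E × E →ₗ[ℝ] ℝ}, 0 ≤ L → Measurable ℓ →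
      Integrable (fun z ↦ ‖A z‖ ^ 2 * gaussWeight L (ℓ z)) → ∀ a : E × E,
      Integrable fun z ↦ ‖A (a + z) * A (a - z)‖ * gaussWeight L (ℓ z) := by
    intro L ℓ hL hℓ hint a
    rw [Measure.volume_eq_prod] at hint ⊢
    refine (((hint.comp_add_left a).add (hint.comp_sub_left a)).const_mul
      ((1 + |ℓ a|) ^ L)).mono' ?_ (Filter.Eventually.of_forall fun z ↦ ?_)
    · exact Measurable.aestronglyMeasurable (by fun_prop)
    · rw [Real.norm_of_nonneg (mul_nonneg (norm_nonneg _) (gaussWeight_nonneg _ _)), norm_mul]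
      simpa using mul_gaussWeight_le hL (ℓ a) (ℓ z)
  have hA0 : ∀ᵐ z, A z = 0 := by
    rw [Measure.volume_eq_prod]
    refine ae_eq_zero_of_forall_ae_mul_eq_zero hAm fun a ↦ ?_
    have hBx := hweight (ℓ := (innerₗ E e).comp (LinearMap.fst ℝ E E)) hM0
      (by simp only [LinearMap.coe_comp, LinearMap.coe_fst]; fun_prop) (by simpa using hx) a
    have hBy := hweight (ℓ := (innerₗ E e).comp (LinearMap.snd ℝ E E)) hN0
      (by simp only [LinearMap.coe_comp, LinearMap.coe_snd]; fun_prop) (by simpa using hy) a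
    have hBm : Measurable fun z ↦ A (a + z) * A (a - z) := by fun_prop
    have hBi : Integrable fun z ↦ A (a + z) * A (a - z) := by
      obtain ⟨C, hC, hC1⟩ := one_le_mul_gaussWeight hM0
      refine (hBx.const_mul C).mono' hBm.aestronglyMeasurable
        (Filter.Eventually.of_forall fun z ↦ ?_)
      rw [mul_left_comm]
      exact le_mul_of_one_le_right (norm_nonneg _) (hC1 _)
    exact ae_eq_zero_of_symplectic_fourier_eq hBm he hMN
      (ae_integral_radar_mul_eq hum hvm hu hv a.1 a.2 (fun z ↦ rfl) hBi)
      (by simpa using hBx) (by simpa using hBy)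
  -- For almost every x the slice has zero Fourier transform, hence vanishes; shifting t by x/2
  -- leaves v at t alone.
  have hslice : ∀ᵐ x : E, ∀ᵐ t : E, u (t + x) = 0 ∨ v t = 0 := by
    rw [Measure.volume_eq_prod] at hA0
    filter_upwards [Measure.ae_ae_of_ae_prod hA0] with x hx0
    have h0 : 𝓕 (radarSlice u v x) =ᵐ[volume] 0 := hx0
    have h1 := ae_fourier_fourier_eq (integrable_radarSlice hu hv x)
      ((integrable_zero E ℂ volume).congr h0.symm)
    have h2 := (measurePreserving_add_right (volume : Measure E)
      ((1 / 2 : ℝ) • x)).quasiMeasurePreserving.ae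
      ((Measure.measurePreserving_neg (volume : Measure E)).quasiMeasurePreserving.ae h1)
    filter_upwards [h2] with t ht
    rw [Real.fourier_congr_ae h0, neg_neg] at ht
    have e1 : t + (1 / 2 : ℝ) • x + (1 / 2 : ℝ) • x = t + x := by module
    rw [radarSlice, e1, add_sub_cancel_right] at ht
    have e2 : u (t + x) * conj (v t) = 0 := by
      rw [← ht, Real.fourier_eq]; simp
    simpa using e2
  rw [Measure.ae_ae_comm] at hslice
  · by_contra hcon
    rw [not_or] at hcon
    obtain ⟨t, ht, ht'⟩ := ((Filter.not_eventually.1 hcon.2).and_eventually hslice).exists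
    refine hcon.1 ?_
    have := (measurePreserving_sub_right (volume : Measure E) t).quasiMeasurePreserving.ae ht'
    filter_upwards [this] with x hx0
    rw [add_sub_cancel] at hx0
    exact hx0.resolve_right ht
  · have h1 : Measurable fun p : E × E ↦ u (p.2 + p.1) := by fun_prop
    have h2 : Measurable fun p : E × E ↦ v p.2 := by fun_prop
    exact (measurableSet_eq_fun h1 measurable_const).union
      (measurableSet_eq_fun h2 measurable_const)

end Directional

/-! ### Passage to coordinates and measurable representatives. -/

lemma radarSlice_ae_congr {E : Type*} [NormedAddCommGroup E] [InnerProductSpace ℝ E]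
    [FiniteDimensional ℝ E] [MeasurableSpace E] [BorelSpace E] {u u' v v' : E → ℂ}
    (hu : u =ᵐ[volume] u') (hv : v =ᵐ[volume] v') (x : E) :
    radarSlice u v x =ᵐ[volume] radarSlice u' v' x := by
  have h1 := (measurePreserving_add_right (volume : Measure E)
    ((1 / 2 : ℝ) • x)).quasiMeasurePreserving.ae hu
  have h2 := (measurePreserving_sub_right (volume : Measure E)
    ((1 / 2 : ℝ) • x)).quasiMeasurePreserving.ae hv
  filter_upwards [h1, h2] with t ht1 ht2
  simp only [radarSlice, ht1, ht2]

open scoped FourierTransform in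
lemma ambiguity_eq_fourier {d : ℕ} (u v : EuclideanSpace ℝ (Fin d) → ℂ)
    (x y : EuclideanSpace ℝ (Fin d)) : ambiguity u v x y = 𝓕 (radarSlice u v x) y := by
  rw [ambiguity, Real.fourier_eq']
  refine integral_congr_ae (Filter.Eventually.of_forall fun t ↦ ?_)
  simp only [radarSlice, smul_eq_mul]
  rw [mul_comm, real_inner_comm y t]
  congr 2
  push_cast
  ring

theorem mainTheorem11 {d : ℕ} (u v : EuclideanSpace ℝ (Fin d) → ℂ)
    (hu : MemLp u 2 volume) (hv : MemLp v 2 volume) (j : Fin d) (M N : ℝ)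
    (hx : ∫⁻ z : EuclideanSpace ℝ (Fin d) × EuclideanSpace ℝ (Fin d),
        ENNReal.ofReal (‖ambiguity u v z.1 z.2‖ ^ 2 *
          (Real.exp (Real.pi * |z.1 j| ^ 2) / (1 + |z.1 j|) ^ M)) < ⊤)
    (hy : ∫⁻ z : EuclideanSpace ℝ (Fin d) × EuclideanSpace ℝ (Fin d),
        ENNReal.ofReal (‖ambiguity u v z.1 z.2‖ ^ 2 *
          (Real.exp (Real.pi * |z.2 j| ^ 2) / (1 + |z.2 j|) ^ N)) < ⊤)
    (hMN : min M N = 1) :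
    u =ᵐ[volume] 0 ∨ v =ᵐ[volume] 0 := by
  have hue := hu.aestronglyMeasurable.ae_eq_mk
  have hve := hv.aestronglyMeasurable.ae_eq_mk
  have hum := hu.aestronglyMeasurable.stronglyMeasurable_mk.measurable
  have hvm := hv.aestronglyMeasurable.stronglyMeasurable_mk.measurable
  set u' := hu.aestronglyMeasurable.mk u
  set v' := hv.aestronglyMeasurable.mk v
  -- Changing u and v on null sets changes each slice on a null set only, so the ambiguity function
  -- is the same at every point.
  simp only [ambiguity_eq_fourier,
    fun x ↦ Real.fourier_congr_ae (radarSlice_ae_congr hue hve x)] at hx hy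
  have hAm := measurable_fourier_slice (measurable_radarSlice hum hvm)
  set e : EuclideanSpace ℝ (Fin d) := EuclideanSpace.single j 1 with he
  have hej : ∀ x : EuclideanSpace ℝ (Fin d), inner ℝ e x = x j := fun x ↦ by
    simp [he, EuclideanSpace.inner_single_left]
  have hint : ∀ (L : ℝ) (c : EuclideanSpace ℝ (Fin d) × EuclideanSpace ℝ (Fin d) → ℝ),
      Measurable c →
      ∫⁻ z, ENNReal.ofReal (‖FourierTransform.fourier (radarSlice u' v' z.1) z.2‖ ^ 2 *
        (Real.exp (Real.pi * |c z| ^ 2) / (1 + |c z|) ^ L)) < ⊤ →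
      Integrable fun z ↦ ‖FourierTransform.fourier (radarSlice u' v' z.1) z.2‖ ^ 2 *
        gaussWeight L (c z) := by
    intro L c hc h
    refine ⟨Measurable.aestronglyMeasurable
      ((hAm.norm.pow_const 2).mul ((measurable_gaussWeight L).comp hc)), ?_⟩
    rw [hasFiniteIntegral_iff_ofReal (Filter.Eventually.of_forall fun z ↦
      mul_nonneg (sq_nonneg _) (gaussWeight_nonneg _ _))]
    exact h
  have hmain := radar_ae_eq_zero_or hum hvm (hu.ae_eq hue) (hv.ae_eq hve) (e := e)
    (by simp [he]) hMN
    (by simpa only [hej] using hint M (fun z ↦ z.1 j) (by fun_prop) hx)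
    (by simpa only [hej] using hint N (fun z ↦ z.2 j) (by fun_prop) hy)
  exact hmain.imp hue.trans hve.trans
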